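/- **Conventions.** A *quantum set* $(B,\psi)$ is a finite-dimensional C*-algebra $B$ with a faithful positive functional $\psi$ such that $mm^*=\mathrm{id}_B$, where $m\colon B\otimes B\to B$ is the multiplication and adjoints are taken for $\langle a,b\rangle_\psi=\psi(a^*b)$. A *quantum graph* on it is a linear map $A\colon B\to B$ with $m(A\otimes A)m^*=A$ and $A(b^*)=A(b)^*$. Quantum graphs $A_1$ on $(B_1,\psi_1)$ and $A_2$ on $(B_2,\psi_2)$ are *quantum isomorphic*, $A_1\cong_q A_2$, if there are a nonzero finite-dimensional Hilbert space $\mathcal H$ and a unital $*$-homomorphism $\rho\colon B_1\to B_2\otimes B(\mathcal H)$ such that $L^2(B_1)\otimes\mathcal H\to L^2(B_2)\otimes\mathcal H$, $a\otimes\xi\mapsto\rho(a)(1\otimes\xi)$, is unitary and $\rho A_1=(A_2\otimes\mathrm{id}_{B(\mathcal H)})\rho$. For a finite set $X$ let $\psi_X(f)=\sum_{x\in X}f(x)$ on $\mathbb C^X$; a finite simple directed graph on $X$ (loops allowed) is identified with the quantum graph $e_x\mapsto\sum_{x\to y}e_y$ on $(\mathbb C^X,\psi_X)$. **Voltage graphs.**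 Let $G$ be a finite abelian group, written additively, with dual group $\hat G$ and $n=|G|$. Let $(\Gamma,\lambda)$ be a voltage graph: a finite directed multigraph $\Gamma$ with vertex set $V$ and edge set $E$, together with a labeling $\lambda\colon E\to G$. Assume that it is *pre-simple*: for all $u,v\in V$ and $g\in G$ there is at most one edge $u\to v$ with label $g$. Its derived graph $\Gamma^\lambda$ has vertex set $V\times G$ and, for every edge $e\colon u\to v$ of $\Gamma$ and every $g\in G$, one edge $(u,g)\to(v,g+\lambda(e))$. For $g\in G$ let $\tilde A_g\colon\mathbb C^V\to\mathbb C^V$, $e_u\mapsto\sum e_v$, the sum running over the edges $u\to v$ with label $g$. **Derived quantum graph.** Let $\hat G$ act on the set $V$, and let $\hat\alpha$ be the induced action $\hat\alpha_\chi(e_v)=e_{\chi\cdot v}$ on $\mathbb C^V$. On the crossed product $B=\mathbb C^V\rtimes_{\hat\alpha}\hat G=\{\sum_\chi b_\chi u_\chi\}$ put $$\psi_\rtimes\Big(\sum_\chi b_\chi u_\chi\Big)=n\,\psi_V(b_1),\qquad E_\rtimes\Big(\sum_\chi b_\chi u_\chi\Big)=n\,b_1,\qquad X_g(b)=\frac1n\sum_{\chi\in\hat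 G}\overline{\chi(g)}\,\langle u_\chi,b\rangle_{\psi_\rtimes}u_\chi,$$ and let $$\Gamma\rtimes_{\hat\alpha}\hat G:=\sum_{g\in G}m\,(X_g\otimes E_\rtimes^*\tilde A_gE_\rtimes)\,m^*\colon B\to B .$$ **Statement.** Suppose that for every $g\in G$ the set of edges of $\Gamma$ with label $g$, viewed as a subset of $V\times V$, is invariant under the action of $\hat G$. Then $(\tilde A_g)_{g\in G}$ is a voltage quantum graph on $(\mathbb C^V,\psi_V)$ with respect to $\hat\alpha$ (that is, $(\mathbb C^V,\psi_V)$ is a quantum set, $\hat\alpha$ preserves $\psi_V$, each $\tilde A_g$ is a quantum graph on it, and each $\tilde A_g$ commutes with all $\hat\alpha_\chi$); $\Gamma^\lambda$ and $\Gamma\rtimes_{\hat\alpha}\hat G$ are quantum graphs on $(\mathbb C^{V\times G},\psi_{V\times G})$ and $(B,\psi_\rtimes)$, respectively; and $$\Gamma^\lambda\cong_q\Gamma\rtimes_{\hat\alpha}\hat G .$$ -/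

import Mathlib

open scoped TensorProduct ComplexConjugate ComplexOrder

namespace QGraph

universe u v w

/-! ### Sesquilinear forms, adjoints and unitaries

A finite-dimensional C*-algebra `B` with a functional `ψ` is regarded as a Hilbert space via
`⟨a, b⟩ = ψ (a* b)`, and tensor products carry the product inner product. -/

/-- Sesquilinear forms, conjugate-linear in the first variable. -/
abbrev Sesq (M : Type*) [AddCommGroup M] [Module ℂ M] : Type _ := M →ₗ⋆[ℂ] M →ₗ[ℂ] ℂ

section Forms

variable {M : Type*} [AddCommGroup M] [Module ℂ M] {N : Type*} [AddCommGroup N] [Module ℂ N]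

/-- The form on `M ⊗ N` with `⟨a ⊗ b, c ⊗ d⟩ = ⟨a, c⟩ ⟨b, d⟩`. -/
noncomputable def tensorForm (F : Sesq M) (F' : Sesq N) : Sesq (M ⊗[ℂ] N) :=
  (TensorProduct.lift (TensorProduct.mapBilinear (RingHom.id ℂ) M N ℂ ℂ)).compr₂
    (LinearMap.mul' ℂ ℂ) ∘ₛₗ TensorProduct.map F F'

@[simp]
theorem tensorForm_tmul (F : Sesq M) (F' : Sesq N) (a c : M) (b d : N) :
    tensorForm F F' (a ⊗ₜ b) (c ⊗ₜ d) = F a c * F' b d := rfl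

/-- `S` is an adjoint of `T`: `⟨T x, y⟩ = ⟨x, S y⟩`. -/
def IsAdjoint (F : Sesq M) (F' : Sesq N) (T : M →ₗ[ℂ] N) (S : N →ₗ[ℂ] M) : Prop :=
  ∀ x y, F' (T x) y = F x (S y)

open Classical in
/-- The adjoint `T*` of `T`. It exists and is unique whenever both forms are inner products and the
spaces are finite-dimensional (the value is `0` if there is no adjoint). -/
noncomputable def adjoint (F : Sesq M) (F' : Sesq N) (T : M →ₗ[ℂ] N) : N →ₗ[ℂ] M :=
  if h : ∃ S, IsAdjoint F F' T S then h.choose else 0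

/-- A unitary operator: a bijective linear map preserving the inner products. -/
def IsUnitary (F : Sesq M) (F' : Sesq N) (T : M →ₗ[ℂ] N) : Prop :=
  Function.Bijective T ∧ ∀ x y, F' (T x) (T y) = F x y

end Forms

/-! ### Quantum sets and quantum graphs -/

section QuantumSets

variable {B : Type*} [Ring B] [StarRing B] [Algebra ℂ B] [StarModule ℂ B]

/-- The inner product `⟨a, b⟩ = ψ (a* b)`. -/
noncomputable def gns (ψ : B →ₗ[ℂ] ℂ) : Sesq B :=
  LinearMap.mk₂'ₛₗ (starRingEnd ℂ) (RingHom.id ℂ) (fun a b => ψ (star a * b))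
    (fun a a' b => by simp [add_mul]) (fun c a b => by simp)
    (fun a b b' => by simp [mul_add]) (fun c a b => by simp)

@[simp]
theorem gns_apply (ψ : B →ₗ[ℂ] ℂ) (a b : B) : gns ψ a b = ψ (star a * b) := rfl

/-- The comultiplication `m*`, the adjoint of the multiplication map `m : B ⊗ B → B`. -/
noncomputable def comul (ψ : B →ₗ[ℂ] ℂ) : B →ₗ[ℂ] B ⊗[ℂ] B :=
  adjoint (tensorForm (gns ψ) (gns ψ)) (gns ψ) (LinearMap.mul' ℂ B)

/-- The Schur product `m (S ⊗ T) m*`. -/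
noncomputable def schur (ψ : B →ₗ[ℂ] ℂ) (S T : B →ₗ[ℂ] B) : B →ₗ[ℂ] B :=
  LinearMap.mul' ℂ B ∘ₗ TensorProduct.map S T ∘ₗ comul ψ

variable (B) in
/-- A unital complex `*`-algebra is a finite-dimensional C*-algebra iff it is finite-dimensional and
has a C*-norm (which is then complete and unique). -/
def IsFinDimCStarAlgebra : Prop :=
  FiniteDimensional ℂ B ∧ ∃ N : AlgebraNorm ℂ B, ∀ a, N (star a * a) = N a ^ 2

/-- `(B, ψ)` is a quantum set: `B` is a finite-dimensional C*-algebra and `ψ` is a faithful positive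
functional with `m m* = id`. -/
structure IsQuantumSet (ψ : B →ₗ[ℂ] ℂ) : Prop where
  cstar : IsFinDimCStarAlgebra B
  positive : ∀ a, 0 ≤ ψ (star a * a)
  faithful : ∀ a, ψ (star a * a) = 0 → a = 0
  special : LinearMap.mul' ℂ B ∘ₗ comul ψ = LinearMap.id

/-- Quantum adjacency matrices: Schur-idempotent and `*`-preserving linear maps. -/
structure IsQuantumAdjacencyMatrix (ψ : B →ₗ[ℂ] ℂ) (A : B →ₗ[ℂ] B) : Prop where
  schur_idem : schur ψ A A = A
  star_preserving : ∀ b, A (star b) = star (A b)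

/-- `A` is a quantum graph on the quantum set `(B, ψ)`. -/
structure IsQuantumGraph (ψ : B →ₗ[ℂ] ℂ) (A : B →ₗ[ℂ] B) : Prop where
  quantumSet : IsQuantumSet ψ
  adjacency : IsQuantumAdjacencyMatrix ψ A

end QuantumSets

/-! ### Quantum isomorphisms -/

section QuantumIsomorphisms

variable {B₁ : Type*} [Ring B₁] [StarRing B₁] [Algebra ℂ B₁] [StarModule ℂ B₁]
  {B₂ : Type*} [Ring B₂] [StarRing B₂] [Algebra ℂ B₂] [StarModule ℂ B₂]
  {H : Type*} [NormedAddCommGroup H] [InnerProductSpace ℂ H] [CompleteSpace H]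

variable (B₂ H) in
/-- The action of `B₂ ⊗ B(H)` on `L²(B₂) ⊗ H`, `(b ⊗ T) (c ⊗ ξ) = b c ⊗ T ξ`. -/
noncomputable def tensorAct :
    B₂ ⊗[ℂ] (H →L[ℂ] H) →ₗ[ℂ] (B₂ ⊗[ℂ] H) →ₗ[ℂ] (B₂ ⊗[ℂ] H) :=
  TensorProduct.map₂ (LinearMap.mul ℂ B₂) (ContinuousLinearMap.coeLM ℂ)

/-- The map `p : L²(B₁) ⊗ H → L²(B₂) ⊗ H`, `a ⊗ ξ ↦ ρ(a) (1 ⊗ ξ)`. -/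
noncomputable def isoMap (ρ : B₁ →⋆ₐ[ℂ] B₂ ⊗[ℂ] (H →L[ℂ] H)) :
    B₁ ⊗[ℂ] H →ₗ[ℂ] B₂ ⊗[ℂ] H :=
  TensorProduct.lift <|
    LinearMap.mk₂ ℂ (fun a ξ => tensorAct B₂ H (ρ a) (1 ⊗ₜ[ℂ] ξ))
      (fun a a' ξ => by simp) (fun c a ξ => by simp)
      (fun a ξ ξ' => by simp [TensorProduct.tmul_add]) (fun c a ξ => by simp)

/-- `ρ` is a quantum isomorphism between the quantum sets `(B₁, ψ₁)` and `(B₂, ψ₂)`. -/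
def IsQuantumSetIso (ψ₁ : B₁ →ₗ[ℂ] ℂ) (ψ₂ : B₂ →ₗ[ℂ] ℂ)
    (ρ : B₁ →⋆ₐ[ℂ] B₂ ⊗[ℂ] (H →L[ℂ] H)) : Prop :=
  IsUnitary (tensorForm (gns ψ₁) (innerₛₗ ℂ)) (tensorForm (gns ψ₂) (innerₛₗ ℂ)) (isoMap ρ)

/-- The quantum graphs `A₁` on `(B₁, ψ₁)` and `A₂` on `(B₂, ψ₂)` are quantum isomorphic: there are a
nonzero finite-dimensional Hilbert space `H` and a quantum isomorphism `ρ : B₁ → B₂ ⊗ B(H)` of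
quantum sets with `ρ A₁ = (A₂ ⊗ id) ρ`. -/
def QuantumIsomorphic (ψ₁ : B₁ →ₗ[ℂ] ℂ) (A₁ : B₁ →ₗ[ℂ] B₁)
    (ψ₂ : B₂ →ₗ[ℂ] ℂ) (A₂ : B₂ →ₗ[ℂ] B₂) : Prop :=
  IsQuantumGraph ψ₁ A₁ ∧ IsQuantumGraph ψ₂ A₂ ∧
  ∃ (H : Type) (_ : NormedAddCommGroup H) (_ : InnerProductSpace ℂ H) (_ : CompleteSpace H)
    (ρ : B₁ →⋆ₐ[ℂ] B₂ ⊗[ℂ] (H →L[ℂ] H)),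
    FiniteDimensional ℂ H ∧ Nontrivial H ∧ IsQuantumSetIso ψ₁ ψ₂ ρ ∧
    ∀ a, ρ (A₁ a) = TensorProduct.map A₂ LinearMap.id (ρ a)

end QuantumIsomorphisms

/-! ### Crossed products by finite groups -/

/-- The crossed product `B ⋊_α K` by a finite group `K`; its elements are the formal sums
`∑ χ, b_χ u_χ`, stored by their coefficients. -/
@[ext]
structure CrossedProduct {K : Type u} {B : Type v} [Group K] [Ring B] [StarRing B] [Algebra ℂ B]
    (α : K →* (B ≃⋆ₐ[ℂ] B)) where
  coeff : K → B

namespace CrossedProduct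

variable {K : Type u} {B : Type v} [Group K] [Ring B] [StarRing B] [Algebra ℂ B]
  {α : K →* (B ≃⋆ₐ[ℂ] B)}

instance : Zero (CrossedProduct α) := ⟨⟨0⟩⟩
instance : Add (CrossedProduct α) := ⟨fun x y => ⟨x.coeff + y.coeff⟩⟩
instance : Neg (CrossedProduct α) := ⟨fun x => ⟨-x.coeff⟩⟩
instance : Sub (CrossedProduct α) := ⟨fun x y => ⟨x.coeff - y.coeff⟩⟩
instance {R : Type*} [SMul R B] : SMul R (CrossedProduct α) := ⟨fun c x => ⟨c • x.coeff⟩⟩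

@[simp] theorem coeff_zero : (0 : CrossedProduct α).coeff = 0 := rfl
@[simp] theorem coeff_add (x y : CrossedProduct α) : (x + y).coeff = x.coeff + y.coeff := rfl
@[simp] theorem coeff_neg (x : CrossedProduct α) : (-x).coeff = -x.coeff := rfl
@[simp] theorem coeff_sub (x y : CrossedProduct α) : (x - y).coeff = x.coeff - y.coeff := rfl
@[simp] theorem coeff_smul {R : Type*} [SMul R B] (c : R) (x : CrossedProduct α) :
    (c • x).coeff = c • x.coeff := rfl

theorem coeff_injective : Function.Injective (coeff : CrossedProduct α → K → B) :=
  fun _ _ h => CrossedProduct.ext h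

instance : AddCommGroup (CrossedProduct α) :=
  coeff_injective.addCommGroup coeff rfl (fun _ _ => rfl) (fun _ => rfl) (fun _ _ => rfl)
    (fun _ _ => rfl) (fun _ _ => rfl)

instance : Module ℂ (CrossedProduct α) :=
  coeff_injective.module ℂ ⟨⟨coeff, rfl⟩, fun _ _ => rfl⟩ (fun _ _ => rfl)

open Classical in
/-- The element `b u_χ`. -/
noncomputable def single (χ : K) (b : B) : CrossedProduct α := ⟨Pi.single χ b⟩

/-- The canonical unitary `u_χ`. -/
noncomputable def u (χ : K) : CrossedProduct α := single χ 1

noncomputable instance : One (CrossedProduct α) := ⟨single 1 1⟩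

theorem coeff_one [DecidableEq K] (χ : K) :
    (1 : CrossedProduct α).coeff χ = if χ = 1 then 1 else 0 := by
  change (single 1 1 : CrossedProduct α).coeff χ = _
  simp [single, Pi.single_apply]

/-- Determined by `(b_χ u_χ)* = α_{χ⁻¹}(b_χ*) u_{χ⁻¹}`. -/
instance : Star (CrossedProduct α) := ⟨fun x => ⟨fun χ => α χ (star (x.coeff χ⁻¹))⟩⟩

@[simp] theorem coeff_star (x : CrossedProduct α) (χ : K) :
    (star x).coeff χ = α χ (star (x.coeff χ⁻¹)) := rfl

variable [Fintype K]

/-- Determined by `(b_χ u_χ) (c_ξ u_ξ) = b_χ α_χ(c_ξ) u_{χ ξ}`. -/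
instance : Mul (CrossedProduct α) :=
  ⟨fun x y => ⟨fun χ => ∑ ξ, x.coeff ξ * α ξ (y.coeff (ξ⁻¹ * χ))⟩⟩

theorem coeff_mul (x y : CrossedProduct α) (χ : K) :
    (x * y).coeff χ = ∑ ξ, x.coeff ξ * α ξ (y.coeff (ξ⁻¹ * χ)) := rfl

noncomputable instance : Ring (CrossedProduct α) where
  __ := (inferInstance : AddCommGroup (CrossedProduct α))
  left_distrib x y z := by
    ext χ; simp [coeff_mul, mul_add, Finset.sum_add_distrib]
  right_distrib x y z := by
    ext χ; simp [coeff_mul, add_mul, Finset.sum_add_distrib]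
  zero_mul x := by ext χ; simp [coeff_mul]
  mul_zero x := by ext χ; simp [coeff_mul]
  one_mul x := by
    classical
    ext χ; simp [coeff_mul, coeff_one, ite_mul]
  mul_one x := by
    classical
    ext χ
    rw [coeff_mul, Finset.sum_eq_single χ]
    · simp [coeff_one]
    · intro ξ _ h
      have : ξ⁻¹ * χ ≠ 1 := fun h' => h (inv_mul_eq_one.mp h')
      simp [coeff_one, this]
    · simp
  mul_assoc x y z := by
    ext χ
    simp only [coeff_mul, Finset.sum_mul, map_sum, map_mul, Finset.mul_sum]
    rw [Finset.sum_comm]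
    refine Finset.sum_congr rfl fun ξ _ => ?_
    refine Fintype.sum_equiv (Equiv.mulLeft ξ⁻¹) _ _ fun ζ => ?_
    have h : α ζ = α ξ * α (ξ⁻¹ * ζ) := by rw [← map_mul, mul_inv_cancel_left]
    rw [h, StarAlgEquiv.mul_apply]
    simp [mul_assoc]

noncomputable instance : Algebra ℂ (CrossedProduct α) :=
  Algebra.ofModule
    (fun c x y => by ext χ; simp [coeff_mul, Finset.smul_sum])
    (fun c x y => by ext χ; simp [coeff_mul, Finset.smul_sum])

noncomputable instance : StarRing (CrossedProduct α) where
  star_involutive x := by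
    ext χ
    simp only [coeff_star, inv_inv, ← map_star, star_star]
    rw [← StarAlgEquiv.mul_apply, ← map_mul, mul_inv_cancel, map_one, StarAlgEquiv.one_apply]
  star_mul x y := by
    ext χ
    simp only [coeff_star, coeff_mul, star_sum, map_sum, star_mul, map_mul, ← map_star]
    refine Fintype.sum_equiv (Equiv.mulLeft χ) _ _ fun ξ => ?_
    simp only [Equiv.coe_mulLeft, ← StarAlgEquiv.mul_apply, ← map_mul]
    simp
  star_add x y := by ext χ; simp

instance [StarModule ℂ B] : StarModule ℂ (CrossedProduct α) where
  star_smul c x := by ext χ; simp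

variable (α) in
/-- The functional `ψ_⋊ (∑ χ, b_χ u_χ) = n ψ(b_1)` with `n = |K|`. -/
noncomputable def functional (ψ : B →ₗ[ℂ] ℂ) : CrossedProduct α →ₗ[ℂ] ℂ where
  toFun x := (Fintype.card K : ℂ) * ψ (x.coeff 1)
  map_add' x y := by simp [mul_add]
  map_smul' c x := by simp [mul_left_comm]

variable (α) in
/-- The scaled conditional expectation `E (∑ χ, b_χ u_χ) = n b_1` with `n = |K|`. -/
noncomputable def expect : CrossedProduct α →ₗ[ℂ] B where
  toFun x := (Fintype.card K : ℂ) • x.coeff 1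
  map_add' x y := by simp
  map_smul' c x := by simp [smul_comm c]

end CrossedProduct

/-! ### Voltage quantum graphs and derived quantum graphs

`G` is a finite abelian group, written additively, and `AddChar G ℂ` is its dual group. -/

section Derived

variable {G : Type u} [AddCommGroup G] [Fintype G]
  {B : Type v} [Ring B] [StarRing B] [Algebra ℂ B] [StarModule ℂ B]
  (ψ : B →ₗ[ℂ] ℂ) (α : AddChar G ℂ →* (B ≃⋆ₐ[ℂ] B))

/-- `A = (A_g)` is a voltage quantum graph on the quantum set `(B, ψ)` with respect to the action
`α` of the dual group on `(B, ψ)`. -/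
structure IsVoltageQuantumGraph (A : G → B →ₗ[ℂ] B) : Prop where
  quantumSet : IsQuantumSet ψ
  action : ∀ χ b, ψ (α χ b) = ψ b
  adjacency : ∀ g, IsQuantumAdjacencyMatrix ψ (A g)
  commute : ∀ g χ b, A g (α χ b) = α χ (A g b)

/-- The map `X_g = (1/n) ∑ χ, conj (χ g) u_χ u_χ†` on the crossed product, where `u_χ†` is the
functional `b ↦ ⟨u_χ, b⟩`. -/
noncomputable def graphX (g : G) : CrossedProduct α →ₗ[ℂ] CrossedProduct α :=
  (1 / (Fintype.card G : ℂ)) • ∑ χ : AddChar G ℂ,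
    conj (χ g) • (gns (CrossedProduct.functional α ψ) (CrossedProduct.u χ)).smulRight
      (CrossedProduct.u χ)

/-- The derived quantum graph `∑ g, m (X_g ⊗ E* A_g E) m*` on the crossed product quantum set. -/
noncomputable def derivedQuantumGraph (A : G → B →ₗ[ℂ] B) :
    CrossedProduct α →ₗ[ℂ] CrossedProduct α :=
  ∑ g, schur (CrossedProduct.functional α ψ) (graphX ψ α g)
    (adjoint (gns (CrossedProduct.functional α ψ)) (gns ψ) (CrossedProduct.expect α) ∘ₗ
      A g ∘ₗ CrossedProduct.expect α)

end Derived

/-! ### Classical graphs -/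

/-- Directed multigraphs (loops and parallel edges allowed) with vertex set `V` and edge set `E`. -/
structure MultiDigraph (V : Type u) (E : Type v) where
  src : E → V
  tgt : E → V

/-- The adjacency matrix as a linear map on `ℂ^V`: the indicator function `e_v` is sent to
`∑ e_w`, summed over all edges `v → w`. -/
def MultiDigraph.adjacencyMap {V : Type u} {E : Type v} [DecidableEq V] [Fintype E]
    (Γ : MultiDigraph V E) : (V → ℂ) →ₗ[ℂ] (V → ℂ) where
  toFun f w := ∑ e, if Γ.tgt e = w then f (Γ.src e) else 0
  map_add' f f' := by
    ext w; simp [← Finset.sum_add_distrib, ← ite_add_zero]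
  map_smul' c f := by
    ext w; simp [Finset.mul_sum]

/-- The functional `ψ_V (f) = ∑ v, f v` on `ℂ^V`. -/
def classicalFunctional (V : Type u) [Fintype V] : (V → ℂ) →ₗ[ℂ] ℂ where
  toFun f := ∑ v, f v
  map_add' f f' := by simp [Finset.sum_add_distrib]
  map_smul' c f := by simp [Finset.mul_sum]

/-- Voltage graphs: directed multigraphs with edges labeled by elements of the group `G`. -/
structure VoltageGraph (V : Type u) (E : Type v) (G : Type w) extends MultiDigraph V E where
  label : E → G

namespace VoltageGraph

variable {V : Type u} {E : Type v} {G : Type w}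

/-- Between any two vertices there is at most one edge with a given label. -/
def IsPreSimple (Γ : VoltageGraph V E G) : Prop :=
  ∀ e f, Γ.src e = Γ.src f → Γ.tgt e = Γ.tgt f → Γ.label e = Γ.label f → e = f

/-- The right derived graph `Γ^λ`: an edge `e : u → v` and `g ∈ G` give an edge
`(e, g) : (u, g) → (v, g + λ(e))`. -/
def derivedGraph [Add G] (Γ : VoltageGraph V E G) : MultiDigraph (V × G) (E × G) where
  src p := (Γ.src p.1, p.2)
  tgt p := (Γ.tgt p.1, p.2 + Γ.label p.1)

/-- The subgraph of all edges with label `g`. -/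
def labeled (Γ : VoltageGraph V E G) (g : G) : MultiDigraph V {e : E // Γ.label e = g} where
  src e := Γ.src e
  tgt e := Γ.tgt e

/-- The family of the adjacency matrices of the subgraphs of equally labeled edges. -/
def adjacencyFamily [DecidableEq V] [DecidableEq G] [Fintype E] (Γ : VoltageGraph V E G) (g : G) :
    (V → ℂ) →ₗ[ℂ] (V → ℂ) :=
  (Γ.labeled g).adjacencyMap

/-- The set of edges with label `g`, as pairs (starting vertex, terminal vertex). -/
def edgeSet (Γ : VoltageGraph V E G) (g : G) : Set (V × V) :=
  {p | ∃ e, Γ.label e = g ∧ Γ.src e = p.1 ∧ Γ.tgt e = p.2}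

/-- The action `α` on the vertices leaves each set of equally labeled edges invariant. -/
def IsInvariant {K : Type*} [Group K] (Γ : VoltageGraph V E G) (α : K →* Equiv.Perm V) : Prop :=
  ∀ χ g, Prod.map (α χ) (α χ) '' Γ.edgeSet g = Γ.edgeSet g

end VoltageGraph

/-- The action on `ℂ^V` induced by an action on `V`: the indicator function `e_v` is sent to
`e_{α_χ v}`. -/
def permAction {K : Type*} [Group K] {V : Type u} (α : K →* Equiv.Perm V) :
    K →* ((V → ℂ) ≃⋆ₐ[ℂ] (V → ℂ)) where
  toFun χ :=
    { toFun := fun f v => f ((α χ)⁻¹ v)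
      invFun := fun f v => f (α χ v)
      left_inv := fun f => by ext v; simp
      right_inv := fun f => by ext v; simp
      map_mul' := fun _ _ => rfl
      map_add' := fun _ _ => rfl
      map_star' := fun _ => rfl
      map_smul' := fun _ _ => rfl }
  map_one' := by ext f v; simp
  map_mul' χ ξ := by ext f v; simp

end QGraph

/-!
Write `K` for the dual group of `G`, and `b u_χ` for the elements of the crossed product `B ⋊ K`.
By orthogonality of characters, the derived quantum graph of a voltage quantum graph `(A_g)` acts
coefficientwise, `b u_χ ↦ (∑ g, conj (χ g) A_g b) u_χ`, for every action of `K` commuting with the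
`A_g`. In particular it is also defined for the trivial action, and there the Fourier transform
`f u_χ ↦ f ⊗ χ` identifies it with the derived graph `Γ^λ`.

It remains to compare the action `α` with the trivial one. Let `K` act on `H = ℓ²(K)` by the left
regular representation `λ`. Then `b ↦ ∑ χ, α_χ(b) ⊗ |e_χ⟩⟨e_χ|` and `u_ξ ↦ u_ξ ⊗ λ_ξ` define a
`*`-homomorphism from the crossed product by the trivial action to `(B ⋊_α K) ⊗ B(H)`, in which the
diagonal twist cancels the action. It intertwines any two coefficientwise operators with the same
coefficients, as long as these commute with `α`.
-/

namespace QGraph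

/-! ### Adjoints and unitaries -/

section Forms

variable {M : Type*} [AddCommGroup M] [Module ℂ M] {N : Type*} [AddCommGroup N] [Module ℂ N]
  {P : Type*} [AddCommGroup P] [Module ℂ P] {Q : Type*} [AddCommGroup Q] [Module ℂ Q]
  {F : Sesq M} {F' : Sesq N} {F₂ : Sesq P} {F₃ : Sesq Q}

theorem adjoint_eq (hF : F.SeparatingRight) {T : M →ₗ[ℂ] N} {S : N →ₗ[ℂ] M}
    (h : IsAdjoint F F' T S) : adjoint F F' T = S := by
  have hex : ∃ S, IsAdjoint F F' T S := ⟨S, h⟩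
  ext y
  rw [adjoint, dif_pos hex, ← sub_eq_zero]
  refine hF _ fun x => ?_
  rw [map_sub, ← hex.choose_spec, ← h, sub_self]

theorem isAdjoint_adjoint [FiniteDimensional ℂ M] (hF : F.SeparatingRight) (T : M →ₗ[ℂ] N) :
    IsAdjoint F F' T (adjoint F F' T) := by
  suffices hex : ∃ S, IsAdjoint F F' T S by
    obtain ⟨S, hS⟩ := hex
    rwa [adjoint_eq hF hS]
  let b := Module.finBasis ℂ M
  let evF : M →ₗ[ℂ] Fin _ → ℂ := LinearMap.pi fun i => F (b i)
  have evF_injective : Function.Injective evF := by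
    refine (injective_iff_map_eq_zero evF).2 fun y hy => hF y fun x => ?_
    have : F.flip y = 0 := b.ext fun i => congrFun hy i
    exact LinearMap.congr_fun this x
  let e := LinearEquiv.ofInjectiveOfFinrankEq evF evF_injective (by simp)
  let S : N →ₗ[ℂ] M := e.symm ∘ₗ LinearMap.pi fun i => F' (T (b i))
  refine ⟨S, fun x y => ?_⟩
  have : F'.flip y ∘ₛₗ T = F.flip (S y) := b.ext fun i =>
    (congrFun (e.apply_symm_apply fun i => F' (T (b i)) y) i).symm
  exact LinearMap.congr_fun this x

theorem separatingRight_tensorForm (hF : F.SeparatingRight) (hF' : F'.SeparatingRight) :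
    (tensorForm F F').SeparatingRight := by
  let c := Module.Basis.ofVectorSpace ℂ N
  intro z hz
  obtain ⟨m, rfl⟩ := TensorProduct.eq_repr_basis_right c z
  have contraction_eq_zero (x : M) : Finsupp.linearCombination ℂ c (m.mapRange (F x) (map_zero _))
      = 0 := by
    refine hF' _ fun y => ?_
    rw [Finsupp.linearCombination_apply, Finsupp.sum_mapRange_index (by simp)]
    simpa [Finsupp.sum] using hz (x ⊗ₜ y)
  have hm : m = 0 := by
    ext j
    refine hF _ fun x => ?_
    simpa using DFunLike.congr_fun
      (c.linearIndependent (contraction_eq_zero x |>.trans (map_zero _).symm)) j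
  simp [hm]

theorem sesq_ext_of_span {F₀ F₁ : Sesq M} {s : Set M} (hs : Submodule.span ℂ s = ⊤)
    (h : ∀ x ∈ s, ∀ y ∈ s, F₀ x y = F₁ x y) : F₀ = F₁ :=
  LinearMap.ext_on hs fun x hx => LinearMap.ext_on hs fun y hy => h x hx y hy

theorem isUnitary_of_span (hF : F.SeparatingRight) {T : M →ₗ[ℂ] N} {s : Set M}
    (hs : Submodule.span ℂ s = ⊤) (hTs : Submodule.span ℂ (T '' s) = ⊤)
    (h : ∀ x ∈ s, ∀ y ∈ s, F' (T x) (T y) = F x y) : IsUnitary F F' T := by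
  have hT : ∀ x y, F' (T x) (T y) = F x y := by
    have : (F'.comp T).compl₂ T = F := sesq_ext_of_span hs h
    exact fun x y => LinearMap.congr_fun₂ this x y
  refine ⟨⟨(injective_iff_map_eq_zero T).2 fun y hy => hF y fun x => ?_, ?_⟩, hT⟩
  · rw [← hT, hy, map_zero]
  · rw [← LinearMap.range_eq_top, LinearMap.range_eq_map, ← hs, Submodule.map_span, hTs]

theorem IsUnitary.comp {T : M →ₗ[ℂ] N} {S : N →ₗ[ℂ] P} (hS : IsUnitary F' F₂ S)
    (hT : IsUnitary F F' T) : IsUnitary F F₂ (S ∘ₗ T) :=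
  ⟨hS.1.comp hT.1, fun x y => (hS.2 _ _).trans (hT.2 x y)⟩

theorem IsUnitary.map {T : M →ₗ[ℂ] N} {S : P →ₗ[ℂ] Q} (hT : IsUnitary F F' T)
    (hS : IsUnitary F₂ F₃ S) :
    IsUnitary (tensorForm F F₂) (tensorForm F' F₃) (TensorProduct.map T S) := by
  refine ⟨TensorProduct.map_bijective hT.1 hS.1, LinearMap.congr_fun₂ (f :=
    ((tensorForm F' F₃).comp (TensorProduct.map T S)).compl₂ (TensorProduct.map T S)) ?_⟩
  refine sesq_ext_of_span (TensorProduct.span_tmul_eq_top ℂ M P) ?_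
  rintro _ ⟨x, p, rfl⟩ _ ⟨y, q, rfl⟩
  simp [hT.2, hS.2]

end Forms

/-! ### Schur products on quantum sets -/

section QuantumSets

variable {B : Type*} [Ring B] [StarRing B] [Algebra ℂ B]

theorem isFinDimCStarAlgebra_of_injective [FiniteDimensional ℂ B] {A : Type*} [NormedRing A]
    [StarRing A] [CStarRing A] [NormedAlgebra ℂ A] (f : B →⋆ₐ[ℂ] A)
    (hf : Function.Injective f) : IsFinDimCStarAlgebra B := by
  let N : AlgebraNorm ℂ B :=
    { toFun := fun a => ‖f a‖
      map_zero' := by simp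
      add_le' := fun a b => by simpa using norm_add_le (f a) (f b)
      neg' := fun a => by simp
      mul_le' := fun a b => by simpa using norm_mul_le (f a) (f b)
      eq_zero_of_map_eq_zero' := fun a ha => by simpa [map_eq_zero_iff f hf] using ha
      smul' := fun c a => by simp [norm_smul] }
  refine ⟨inferInstance, N, fun a => ?_⟩
  change ‖f (star a * a)‖ = ‖f a‖ ^ 2
  rw [map_mul, map_star, CStarRing.norm_star_mul_self, sq]

variable [StarModule ℂ B] {ψ : B →ₗ[ℂ] ℂ}

theorem map_star_of_nonneg (hψ : ∀ a, 0 ≤ ψ (star a * a)) (a : B) : ψ (star a) = conj (ψ a) := by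
  have im_eq_zero (b : B) : (ψ (star b * b)).im = 0 := (Complex.nonneg_iff.1 (hψ b)).2.symm
  have polarized (c : ℂ) : (c * ψ (star a) + conj c * ψ a).im = 0 := by
    have expand : ψ (star (a + c • 1) * (a + c • 1)) =
        ψ (star a * a) + (c * ψ (star a) + conj c * ψ a) + ψ (star (c • 1) * (c • 1)) := by
      simp [mul_add, add_mul]
      ring
    have := congrArg Complex.im expand
    rwa [Complex.add_im, Complex.add_im, im_eq_zero, im_eq_zero, im_eq_zero, zero_add, add_zero,
      eq_comm] at this
  apply Complex.ext
  · simpa [sub_eq_zero, ← sub_eq_add_neg] using polarized Complex.I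
  · simpa [add_eq_zero_iff_eq_neg] using polarized 1

theorem isFinDimCStarAlgebra_of_faithful [FiniteDimensional ℂ B]
    (hpos : ∀ a, 0 ≤ ψ (star a * a)) (hfaithful : ∀ a, ψ (star a * a) = 0 → a = 0) :
    IsFinDimCStarAlgebra B := by
  let core : InnerProductSpace.Core ℂ B :=
    { inner := fun a b => ψ (star a * b)
      conj_inner_symm := fun a b => by rw [← map_star_of_nonneg hpos]; simp
      re_inner_nonneg := fun a => (Complex.le_def.1 (hpos a)).1
      add_left := fun a b d => by simp [add_mul]
      smul_left := fun a b r => by simp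
      definite := hfaithful }
  let _ : NormedAddCommGroup B := core.toNormedAddCommGroup
  let _ : InnerProductSpace ℂ B := InnerProductSpace.ofCore core.toCore
  have _ : CompleteSpace B := FiniteDimensional.complete ℂ B
  let leftMul : B →ₐ[ℂ] B →L[ℂ] B :=
    (Module.End.toContinuousLinearMap B).toAlgHom.comp (Algebra.lmul ℂ B)
  have leftMul_apply (a b : B) : leftMul a b = a * b := rfl
  have leftMul_star (a : B) : leftMul (star a) = star (leftMul a) := by
    refine ContinuousLinearMap.eq_adjoint_iff _ _ |>.2 fun x y => ?_
    change ψ (star (star a * x) * y) = ψ (star x * (a * y))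
    simp [mul_assoc]
  refine isFinDimCStarAlgebra_of_injective (A := B →L[ℂ] B)
    { leftMul with map_star' := leftMul_star } fun a b hab => ?_
  simpa [leftMul_apply] using DFunLike.congr_fun hab 1

theorem separatingRight_gns (hψ : ∀ a, ψ (star a * a) = 0 → a = 0) : (gns ψ).SeparatingRight :=
  fun y hy => hψ y (hy y)

namespace IsQuantumSet

theorem finiteDimensional (h : IsQuantumSet ψ) : FiniteDimensional ℂ B := h.cstar.1

theorem separatingRight (h : IsQuantumSet ψ) : (gns ψ).SeparatingRight :=
  separatingRight_gns h.faithful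

end IsQuantumSet

theorem gns_mul_eq_tensorForm_comul [FiniteDimensional ℂ B] (hψ : (gns ψ).SeparatingRight)
    (a b y : B) : gns ψ (a * b) y = tensorForm (gns ψ) (gns ψ) (a ⊗ₜ b) (comul ψ y) :=
  isAdjoint_adjoint (separatingRight_tensorForm hψ hψ) (LinearMap.mul' ℂ B) (a ⊗ₜ b) y

theorem comul_eq [FiniteDimensional ℂ B] (hψ : (gns ψ).SeparatingRight) {y : B} {z : B ⊗[ℂ] B}
    (h : ∀ a b, gns ψ (a * b) y = tensorForm (gns ψ) (gns ψ) (a ⊗ₜ b) z) : comul ψ y = z := by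
  rw [← sub_eq_zero]
  refine separatingRight_tensorForm hψ hψ _ fun x => ?_
  induction x using TensorProduct.induction_on with
  | zero => simp
  | add x x' hx hx' => rw [map_add, LinearMap.add_apply, hx, hx', add_zero]
  | tmul a b => rw [map_sub, ← gns_mul_eq_tensorForm_comul hψ, h, sub_self]

theorem lid_rTensor_comul [FiniteDimensional ℂ B] (hψ : (gns ψ).SeparatingRight) (y : B) :
    TensorProduct.lid ℂ B (ψ.rTensor B (comul ψ y)) = y := by
  have slice (a : B) (z : B ⊗[ℂ] B) : gns ψ a (TensorProduct.lid ℂ B (ψ.rTensor B z)) =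
      tensorForm (gns ψ) (gns ψ) (1 ⊗ₜ a) z := by
    induction z using TensorProduct.induction_on with
    | zero => simp
    | add z z' hz hz' => simp only [map_add, hz, hz']
    | tmul b c => simp
  rw [← sub_eq_zero]
  refine hψ _ fun a => ?_
  rw [map_sub, slice, ← gns_mul_eq_tensorForm_comul hψ, one_mul, sub_self]

theorem schur_smulRight_one_left [FiniteDimensional ℂ B] (hψ : (gns ψ).SeparatingRight)
    (T : B →ₗ[ℂ] B) : schur ψ (ψ.smulRight 1) T = T := by
  ext y
  have : LinearMap.mul' ℂ B ∘ₗ TensorProduct.map (ψ.smulRight 1) T =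
      T ∘ₗ TensorProduct.lid ℂ B ∘ₗ ψ.rTensor B := by
    ext; simp
  rw [schur, ← LinearMap.comp_assoc, this]
  exact congrArg T (lid_rTensor_comul hψ y)

theorem schur_id : schur ψ LinearMap.id LinearMap.id = LinearMap.mul' ℂ B ∘ₗ comul ψ := by
  rw [schur, TensorProduct.map_id, LinearMap.id_comp]

theorem schur_smul_left (c : ℂ) (S T : B →ₗ[ℂ] B) :
    schur ψ (c • S) T = c • schur ψ S T := by
  simp [schur, TensorProduct.map_smul_left, LinearMap.comp_smul, LinearMap.smul_comp]

theorem schur_smul_right (c : ℂ) (S T : B →ₗ[ℂ] B) :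
    schur ψ S (c • T) = c • schur ψ S T := by
  simp [schur, TensorProduct.map_smul_right, LinearMap.comp_smul, LinearMap.smul_comp]

theorem schur_zero_right (S : B →ₗ[ℂ] B) : schur ψ S 0 = 0 := by
  simpa using schur_smul_right 0 S 0

theorem schur_sum_left {ι : Type*} (s : Finset ι) (S : ι → B →ₗ[ℂ] B) (T : B →ₗ[ℂ] B) :
    schur ψ (∑ i ∈ s, S i) T = ∑ i ∈ s, schur ψ (S i) T := by
  ext y; simp [schur, ← TensorProduct.mapBilinear_apply]

theorem schur_sum_right {ι : Type*} (s : Finset ι) (S : B →ₗ[ℂ] B) (T : ι → B →ₗ[ℂ] B) :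
    schur ψ S (∑ i ∈ s, T i) = ∑ i ∈ s, schur ψ S (T i) := by
  ext y; simp [schur, ← TensorProduct.mapBilinear_apply]

end QuantumSets

/-! ### Crossed products as quantum sets -/

namespace CrossedProduct

section Coefficients

variable {K B : Type*} [Group K] [Ring B] [StarRing B] [Algebra ℂ B] {α : K →* (B ≃⋆ₐ[ℂ] B)}

variable (α) in
/-- The crossed product as the vector space of its coefficient families. -/
def coeffEquiv : CrossedProduct α ≃ₗ[ℂ] (K → B) where
  toFun x := x.coeff
  invFun f := ⟨f⟩
  map_add' _ _ := rfl
  map_smul' _ _ := rfl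

theorem act_act_inv (χ : K) (b : B) : α χ (α χ⁻¹ b) = b := by
  rw [← StarAlgEquiv.mul_apply, ← map_mul, mul_inv_cancel, map_one, StarAlgEquiv.one_apply]

variable (α) in
/-- The map `b ↦ b u_χ`. -/
noncomputable def singleₗ (χ : K) : B →ₗ[ℂ] CrossedProduct α where
  toFun := single χ
  map_add' a b := by ext; simp [single, Pi.single_add]
  map_smul' c b := by ext; simp [single, Pi.single_smul]

theorem coeff_singleₗ [DecidableEq K] (χ : K) (b : B) :
    (singleₗ α χ b).coeff = Pi.single χ b := by
  simp only [singleₗ, single, LinearMap.coe_mk, AddHom.coe_mk]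
  congr!

theorem coeffEquiv_singleₗ [DecidableEq K] (χ : K) (b : B) :
    coeffEquiv α (singleₗ α χ b) = Pi.single χ b :=
  coeff_singleₗ (α := α) χ b

/-- The operator `∑ χ, b_χ u_χ ↦ ∑ χ, s_χ(b_χ) u_χ`. -/
def mapCoeff (s : K → B →ₗ[ℂ] B) : CrossedProduct α →ₗ[ℂ] CrossedProduct α :=
  (coeffEquiv α).symm ∘ₗ LinearMap.piMap s ∘ₗ coeffEquiv α

theorem coeff_mapCoeff (s : K → B →ₗ[ℂ] B) (x : CrossedProduct α) (χ : K) :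
    (mapCoeff s x).coeff χ = s χ (x.coeff χ) := rfl

theorem mapCoeff_singleₗ (s : K → B →ₗ[ℂ] B) (χ : K) (b : B) :
    mapCoeff s (singleₗ α χ b) = singleₗ α χ (s χ b) := by
  classical
  ext ξ
  obtain rfl | h := eq_or_ne ξ χ <;> simp [coeff_mapCoeff, coeff_singleₗ, *]

theorem star_singleₗ (χ : K) (b : B) :
    star (singleₗ α χ b) = singleₗ α χ⁻¹ (α χ⁻¹ (star b)) := by
  classical
  ext ξ
  obtain rfl | h := eq_or_ne ξ χ⁻¹
  · simp [coeff_singleₗ]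
  · simp [coeff_singleₗ, h, inv_eq_iff_eq_inv]

instance [Finite K] [FiniteDimensional ℂ B] : FiniteDimensional ℂ (CrossedProduct α) :=
  (coeffEquiv α).symm.finiteDimensional

variable [Fintype K]

theorem sum_singleₗ_coeff (x : CrossedProduct α) : ∑ χ, singleₗ α χ (x.coeff χ) = x := by
  classical
  apply (coeffEquiv α).injective
  simp only [map_sum, coeffEquiv_singleₗ]
  exact Finset.univ_sum_single x.coeff

theorem functional_apply (ψ : B →ₗ[ℂ] ℂ) (x : CrossedProduct α) :
    functional α ψ x = (Fintype.card K : ℂ) * ψ (x.coeff 1) := rfl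

theorem linearMap_ext {M : Type*} [AddCommGroup M] [Module ℂ M] {S T : CrossedProduct α →ₗ[ℂ] M}
    (h : ∀ χ b, S (singleₗ α χ b) = T (singleₗ α χ b)) : S = T := by
  ext x
  rw [← sum_singleₗ_coeff x, map_sum, map_sum]
  exact Finset.sum_congr rfl fun χ _ => h χ _

theorem singleₗ_mul_singleₗ (χ ξ : K) (a b : B) :
    singleₗ α χ a * singleₗ α ξ b = singleₗ α (χ * ξ) (a * α χ b) := by
  classical
  ext ζ
  rw [coeff_mul, Finset.sum_eq_single χ (fun η _ h => by simp [coeff_singleₗ, h]) (by simp)]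
  obtain rfl | h := eq_or_ne ζ (χ * ξ)
  · simp [coeff_singleₗ]
  · simp [coeff_singleₗ, h, inv_mul_eq_iff_eq_mul]

end Coefficients

section Functional

variable {K B : Type*} [Group K] [Fintype K] [Ring B] [StarRing B] [Algebra ℂ B] [StarModule ℂ B]
  {α : K →* (B ≃⋆ₐ[ℂ] B)} {ψ : B →ₗ[ℂ] ℂ}

theorem gns_functional (hα : ∀ χ b, ψ (α χ b) = ψ b) (x y : CrossedProduct α) :
    gns (functional α ψ) x y = Fintype.card K * ∑ χ, gns ψ (x.coeff χ) (y.coeff χ) := by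
  simp only [gns_apply, functional_apply, coeff_mul, coeff_star, map_sum, ← map_mul, hα, mul_one]
  congr 1
  exact Equiv.sum_comp (Equiv.inv K) fun χ => ψ (star (x.coeff χ) * y.coeff χ)

theorem gns_functional_singleₗ (hα : ∀ χ b, ψ (α χ b) = ψ b) (x : CrossedProduct α) (χ : K)
    (b : B) : gns (functional α ψ) x (singleₗ α χ b) =
      Fintype.card K * gns ψ (x.coeff χ) b := by
  classical
  rw [gns_functional hα, Finset.sum_eq_single χ] <;> simp +contextual [coeff_singleₗ]

theorem separatingRight_gns_functional (hα : ∀ χ b, ψ (α χ b) = ψ b)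
    (hψ : (gns ψ).SeparatingRight) : (gns (functional α ψ)).SeparatingRight := by
  classical
  intro y hy
  ext χ
  refine hψ _ fun b => ?_
  have := hy (singleₗ α χ b)
  rw [gns_functional hα, Finset.sum_eq_single χ (fun ξ _ h => by simp [coeff_singleₗ, h])
    (by simp)] at this
  simpa [coeff_singleₗ] using this

theorem comul_functional_singleₗ [FiniteDimensional ℂ B] (hα : ∀ χ b, ψ (α χ b) = ψ b)
    (hψ : (gns ψ).SeparatingRight) (ξ : K) (b : B) :
    comul (functional α ψ) (singleₗ α ξ b) = (Fintype.card K : ℂ)⁻¹ • ∑ χ,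
      TensorProduct.map (singleₗ α χ) (singleₗ α (χ⁻¹ * ξ) ∘ₗ (α χ⁻¹ : B →ₗ[ℂ] B)) (comul ψ b) := by
  refine comul_eq (separatingRight_gns_functional hα hψ) fun x y => ?_
  have tensorForm_map (χ : K) (z : B ⊗[ℂ] B) :
      tensorForm (gns (functional α ψ)) (gns (functional α ψ)) (x ⊗ₜ y)
        (TensorProduct.map (singleₗ α χ) (singleₗ α (χ⁻¹ * ξ) ∘ₗ (α χ⁻¹ : B →ₗ[ℂ] B)) z) =
      Fintype.card K ^ 2 *
        tensorForm (gns ψ) (gns ψ) (x.coeff χ ⊗ₜ α χ (y.coeff (χ⁻¹ * ξ))) z := by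
    induction z using TensorProduct.induction_on with
    | zero => simp
    | add z z' hz hz' => simp only [map_add, hz, hz', mul_add]
    | tmul a c =>
      have gns_act : gns ψ (y.coeff (χ⁻¹ * ξ)) (α χ⁻¹ c) = gns ψ (α χ (y.coeff (χ⁻¹ * ξ))) c := by
        rw [gns_apply, gns_apply, ← hα χ, map_mul, act_act_inv, map_star]
      simp only [TensorProduct.map_tmul, tensorForm_tmul, gns_functional_singleₗ hα,
        LinearMap.comp_apply, LinearMap.coe_coe, gns_act]
      ring
  simp only [map_smul, map_sum, tensorForm_map, ← gns_mul_eq_tensorForm_comul hψ]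
  rw [gns_functional_singleₗ hα, coeff_mul, map_sum, LinearMap.sum_apply, ← Finset.mul_sum,
    smul_eq_mul, ← mul_assoc, sq, inv_mul_cancel_left₀ (by simp)]

theorem schur_mapCoeff [FiniteDimensional ℂ B] (hα : ∀ χ b, ψ (α χ b) = ψ b)
    (hψ : (gns ψ).SeparatingRight) (s : K → B →ₗ[ℂ] B) {t : K → B →ₗ[ℂ] B}
    (ht : ∀ ξ χ b, t ξ (α χ b) = α χ (t ξ b)) :
    schur (functional α ψ) (mapCoeff s) (mapCoeff t) =
      mapCoeff fun ξ => (Fintype.card K : ℂ)⁻¹ • ∑ χ, schur ψ (s χ) (t (χ⁻¹ * ξ)) := by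
  refine linearMap_ext fun ξ b => ?_
  have mul_map (χ : K) (z : B ⊗[ℂ] B) :
      LinearMap.mul' ℂ _ (TensorProduct.map (mapCoeff s) (mapCoeff t)
        (TensorProduct.map (singleₗ α χ) (singleₗ α (χ⁻¹ * ξ) ∘ₗ (α χ⁻¹ : B →ₗ[ℂ] B)) z)) =
      singleₗ α ξ (LinearMap.mul' ℂ B (TensorProduct.map (s χ) (t (χ⁻¹ * ξ)) z)) := by
    induction z using TensorProduct.induction_on with
    | zero => simp
    | add z z' hz hz' => simp only [map_add, hz, hz']
    | tmul a c =>
      simp only [TensorProduct.map_tmul, mapCoeff_singleₗ, LinearMap.comp_apply,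
        LinearMap.coe_coe, LinearMap.mul'_apply, singleₗ_mul_singleₗ, mul_inv_cancel_left, ← ht,
        act_act_inv]
  simp only [schur, LinearMap.comp_apply, comul_functional_singleₗ hα hψ, mapCoeff_singleₗ,
    map_smul, map_sum, mul_map, LinearMap.smul_apply, LinearMap.sum_apply]

end Functional

end CrossedProduct

open CrossedProduct in
theorem IsQuantumSet.crossedProduct {K B : Type*} [Group K] [Fintype K] [Ring B] [StarRing B]
    [Algebra ℂ B] [StarModule ℂ B] {ψ : B →ₗ[ℂ] ℂ} {α : K →* (B ≃⋆ₐ[ℂ] B)} (h : IsQuantumSet ψ)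
    (hα : ∀ χ b, ψ (α χ b) = ψ b) : IsQuantumSet (functional α ψ) := by
  have := h.finiteDimensional
  have hpos (x : CrossedProduct α) : 0 ≤ functional α ψ (star x * x) := by
    rw [← gns_apply, gns_functional hα]
    exact mul_nonneg (Nat.cast_nonneg _) (Finset.sum_nonneg fun χ _ => h.positive _)
  have hfaithful (x : CrossedProduct α) (hx : functional α ψ (star x * x) = 0) : x = 0 := by
    rw [← gns_apply, gns_functional hα, mul_eq_zero, or_iff_right (by simp)] at hx
    rw [Finset.sum_eq_zero_iff_of_nonneg fun χ _ => by exact h.positive (x.coeff χ)] at hx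
    ext χ
    exact h.faithful _ (hx χ (Finset.mem_univ χ))
  refine ⟨isFinDimCStarAlgebra_of_faithful hpos hfaithful, hpos, hfaithful, ?_⟩
  have mapCoeff_id : mapCoeff (α := α) (fun _ => LinearMap.id) = LinearMap.id := rfl
  rw [← schur_id, ← mapCoeff_id, schur_mapCoeff hα h.separatingRight _ fun _ _ _ => rfl, schur_id,
    h.special]
  simp [← Nat.cast_smul_eq_nsmul ℂ]

/-! ### Derived quantum graphs as Fourier transforms -/

section DerivedQuantumGraph

open CrossedProduct

theorem singleₗ_comp_expect {K B : Type*} [Group K] [Fintype K] [DecidableEq K] [Ring B]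
    [StarRing B] [Algebra ℂ B] {α : K →* (B ≃⋆ₐ[ℂ] B)} (T : B →ₗ[ℂ] B) :
    singleₗ α 1 ∘ₗ T ∘ₗ expect α = mapCoeff (Pi.single 1 ((Fintype.card K : ℂ) • T)) := by
  ext x χ
  change (singleₗ α 1 (T ((Fintype.card K : ℂ) • x.coeff 1))).coeff χ = _
  obtain rfl | h := eq_or_ne χ 1 <;> simp [coeff_singleₗ, coeff_mapCoeff, *]

theorem adjoint_expect {K B : Type*} [Group K] [Fintype K] [Ring B] [StarRing B] [Algebra ℂ B]
    [StarModule ℂ B] {ψ : B →ₗ[ℂ] ℂ} {α : K →* (B ≃⋆ₐ[ℂ] B)} (hα : ∀ χ b, ψ (α χ b) = ψ b)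
    (hψ : (gns ψ).SeparatingRight) :
    adjoint (gns (functional α ψ)) (gns ψ) (expect α) = singleₗ α 1 := by
  refine adjoint_eq (separatingRight_gns_functional hα hψ) fun x b => ?_
  rw [gns_functional_singleₗ hα]
  change gns ψ ((Fintype.card K : ℂ) • x.coeff 1) b = _
  simp

variable {G : Type*} [AddCommGroup G] {B : Type*} [Ring B] [StarRing B] [Algebra ℂ B]
  [StarModule ℂ B] {ψ : B →ₗ[ℂ] ℂ} {α : AddChar G ℂ →* (B ≃⋆ₐ[ℂ] B)} {A : G → B →ₗ[ℂ] B}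

theorem IsVoltageQuantumGraph.trivialAction (h : IsVoltageQuantumGraph ψ α A) :
    IsVoltageQuantumGraph ψ 1 A where
  quantumSet := h.quantumSet
  action _ _ := rfl
  adjacency := h.adjacency
  commute _ _ _ := rfl

variable [Fintype G]

/-- The Fourier transform of a function on `G` with values in a complex vector space, without
normalization. -/
noncomputable def fourierTransform {W : Type*} [AddCommGroup W] [Module ℂ W] (f : G → W)
    (χ : AddChar G ℂ) : W :=
  ∑ g, conj (χ g) • f g

theorem sum_schur_fourierTransform (A A' : G → B →ₗ[ℂ] B) (ξ : AddChar G ℂ) :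
    (Fintype.card (AddChar G ℂ) : ℂ)⁻¹ •
      ∑ χ, schur ψ (fourierTransform A χ) (fourierTransform A' (χ⁻¹ * ξ)) =
    fourierTransform (fun g => schur ψ (A g) (A' g)) ξ := by
  classical
  have orthogonality (g h : G) : ∑ χ : AddChar G ℂ, conj ((χ⁻¹ * ξ) h) * conj (χ g) =
      if g = h then Fintype.card (AddChar G ℂ) * conj (ξ g) else 0 := by
    have (χ : AddChar G ℂ) : conj ((χ⁻¹ * ξ) h) * conj (χ g) = conj (ξ h) * χ (h - g) := by
      rw [AddChar.mul_apply, AddChar.inv_apply, map_mul, ← AddChar.map_neg_eq_conj χ (-h), neg_neg,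
        ← AddChar.map_neg_eq_conj χ g, sub_eq_add_neg, AddChar.map_add_eq_mul]
      ring
    simp only [this, ← Finset.mul_sum, AddChar.sum_apply_eq_ite, sub_eq_zero, eq_comm (a := h),
      AddChar.card_eq]
    split_ifs with hgh
    · rw [hgh, mul_comm]
    · rw [mul_zero]
  simp only [fourierTransform, schur_sum_left, schur_sum_right, schur_smul_left, schur_smul_right,
    Finset.smul_sum, smul_smul]
  calc ∑ χ : AddChar G ℂ, ∑ h, ∑ g, _
    _ = ∑ g, ∑ h, ((Fintype.card (AddChar G ℂ) : ℂ)⁻¹ *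
          ∑ χ : AddChar G ℂ, conj ((χ⁻¹ * ξ) h) * conj (χ g)) • schur ψ (A g) (A' h) := by
      rw [Finset.sum_comm_cycle]
      refine Finset.sum_congr rfl fun g _ => ?_
      rw [Finset.sum_comm]
      simp only [Finset.mul_sum, Finset.sum_smul]
    _ = ∑ g, conj (ξ g) • schur ψ (A g) (A' g) := by
      simp only [orthogonality, mul_ite, mul_zero, ite_smul, zero_smul, Finset.sum_ite_eq,
        Finset.mem_univ, if_true]
      simp

theorem graphX_eq_mapCoeff (hα : ∀ χ b, ψ (α χ b) = ψ b) (g : G) :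
    graphX ψ α g = mapCoeff fun χ => conj (χ g) • ψ.smulRight 1 := by
  classical
  refine linearMap_ext fun ξ b => ?_
  have gns_u (χ : AddChar G ℂ) : gns (functional α ψ) (singleₗ α χ 1) (singleₗ α ξ b) =
      if ξ = χ then (Fintype.card G : ℂ) * ψ b else 0 := by
    rw [gns_functional_singleₗ hα, AddChar.card_eq, coeff_singleₗ]
    obtain rfl | h := eq_or_ne ξ χ <;> simp [*]
  rw [mapCoeff_singleₗ]
  change ((1 / (Fintype.card G : ℂ)) • ∑ χ : AddChar G ℂ, conj (χ g) •
    (gns (functional α ψ) (singleₗ α χ 1)).smulRight (singleₗ α χ 1)) (singleₗ α ξ b) = _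
  simp only [LinearMap.smul_apply, LinearMap.sum_apply, LinearMap.smulRight_apply, gns_u, ite_smul,
    zero_smul, smul_ite, smul_zero, Finset.sum_ite_eq, Finset.mem_univ, if_true, map_smul]
  simp [smul_smul, mul_left_comm]

theorem derivedQuantumGraph_eq_mapCoeff (h : IsVoltageQuantumGraph ψ α A) :
    derivedQuantumGraph ψ α A = mapCoeff (fourierTransform A) := by
  classical
  have := h.quantumSet.finiteDimensional
  have hψ := h.quantumSet.separatingRight
  have summand (g : G) : schur (functional α ψ) (graphX ψ α g)
      (adjoint (gns (functional α ψ)) (gns ψ) (expect α) ∘ₗ A g ∘ₗ expect α) =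
      mapCoeff fun χ => conj (χ g) • A g := by
    rw [adjoint_expect h.action hψ, graphX_eq_mapCoeff h.action, singleₗ_comp_expect,
      schur_mapCoeff h.action hψ]
    · refine congrArg mapCoeff (funext fun ξ => ?_)
      rw [Finset.sum_eq_single ξ]
      · simp [schur_smul_left, schur_smul_right, schur_smulRight_one_left hψ]
      · intro χ _ hχ
        simp [schur_zero_right, inv_mul_eq_one, hχ]
      · simp
    · intro ξ χ b
      obtain rfl | hξ := eq_or_ne ξ 1 <;> simp [h.commute, *]
  rw [derivedQuantumGraph]
  simp only [summand]
  refine linearMap_ext fun ξ b => ?_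
  simp only [LinearMap.sum_apply, mapCoeff_singleₗ, fourierTransform, ← map_sum]

theorem IsVoltageQuantumGraph.fourierTransform_act (h : IsVoltageQuantumGraph ψ α A)
    (ξ χ : AddChar G ℂ) (b : B) :
    fourierTransform A ξ (α χ b) = α χ (fourierTransform A ξ b) := by
  simp [fourierTransform, h.commute]

theorem IsVoltageQuantumGraph.isQuantumGraph_derivedQuantumGraph
    (h : IsVoltageQuantumGraph ψ α A) :
    IsQuantumGraph (functional α ψ) (derivedQuantumGraph ψ α A) := by
  have := h.quantumSet.finiteDimensional
  rw [derivedQuantumGraph_eq_mapCoeff h]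
  refine ⟨h.quantumSet.crossedProduct h.action, ?_, fun x => ?_⟩
  · rw [schur_mapCoeff h.action h.quantumSet.separatingRight _ h.fourierTransform_act]
    simp only [sum_schur_fourierTransform, (h.adjacency _).schur_idem]
  · ext ξ
    simp only [coeff_mapCoeff, coeff_star, h.fourierTransform_act]
    simp [fourierTransform, (h.adjacency _).star_preserving, AddChar.map_neg_eq_conj]

end DerivedQuantumGraph

/-! ### Representations of crossed products -/

section CrossedProductLift

namespace CrossedProduct

variable {K B M : Type*} [Group K] [Fintype K] [Ring B] [StarRing B] [Algebra ℂ B]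
  [AddCommGroup M] [Module ℂ M] {α : K →* (B ≃⋆ₐ[ℂ] B)}

variable (α) in
/-- The linear map `∑ χ, b_χ u_χ ↦ ∑ χ, φ_χ(b_χ)`. -/
noncomputable def sumCoeff (φ : K → B →ₗ[ℂ] M) : CrossedProduct α →ₗ[ℂ] M :=
  (∑ χ, φ χ ∘ₗ LinearMap.proj χ) ∘ₗ (coeffEquiv α).toLinearMap

theorem sumCoeff_singleₗ (φ : K → B →ₗ[ℂ] M) (χ : K) (b : B) :
    sumCoeff α φ (singleₗ α χ b) = φ χ b := by
  classical
  simp [sumCoeff, coeffEquiv_singleₗ, Pi.single_apply, apply_ite]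

variable {C : Type*} [Ring C] [StarRing C] [Algebra ℂ C]

variable (α) in
/-- The embedding `b ↦ b u_1` of `B` into its crossed product. -/
noncomputable def embed : B →⋆ₐ[ℂ] CrossedProduct α :=
  { toAlgHom := AlgHom.ofLinearMap (singleₗ α 1) rfl fun a b => by simp [singleₗ_mul_singleₗ]
    map_star' := fun b => by
      change singleₗ α 1 (star b) = star (singleₗ α 1 b)
      simp [star_singleₗ] }

/-- The universal property of the crossed product: a covariant pair `(π, U)` of a representation
of `B` and a unitary representation of `K` integrates to `b u_χ ↦ π(b) U_χ`. -/
noncomputable def lift (π : B →⋆ₐ[ℂ] C) (U : K →* C)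
    (hU : ∀ χ, star (U χ) = U χ⁻¹) (hπU : ∀ χ b, U χ * π b = π (α χ b) * U χ) :
    CrossedProduct α →⋆ₐ[ℂ] C :=
  let φ := sumCoeff α fun χ => LinearMap.mulRight ℂ (U χ) ∘ₗ (π : B →ₐ[ℂ] C).toLinearMap
  have φ_singleₗ (χ : K) (b : B) : φ (singleₗ α χ b) = π b * U χ := sumCoeff_singleₗ _ χ b
  have φ_mul : (LinearMap.mul ℂ _).compr₂ φ = (LinearMap.mul ℂ C).compl₁₂ φ φ :=
    linearMap_ext fun χ a => linearMap_ext fun ξ b => by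
      simp only [LinearMap.compr₂_apply, LinearMap.compl₁₂_apply, LinearMap.mul_apply',
        singleₗ_mul_singleₗ, φ_singleₗ, map_mul, mul_assoc]
      rw [← mul_assoc (U χ), hπU, mul_assoc]
  { toAlgHom := AlgHom.ofLinearMap φ ((φ_singleₗ 1 1).trans (by simp))
      fun x y => LinearMap.congr_fun₂ φ_mul x y
    map_star' := fun x => by
      change φ (star x) = star (φ x)
      rw [← sum_singleₗ_coeff x]
      simp only [star_sum, map_sum, star_singleₗ, φ_singleₗ, star_mul, hU, ← map_star π,
        hπU] }

theorem lift_singleₗ (π : B →⋆ₐ[ℂ] C) (U : K →* C)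
    (hU : ∀ χ, star (U χ) = U χ⁻¹) (hπU : ∀ χ b, U χ * π b = π (α χ b) * U χ) (χ : K) (b : B) :
    lift π U hU hπU (singleₗ α χ b) = π b * U χ :=
  sumCoeff_singleₗ _ χ b

end CrossedProduct

end CrossedProductLift

section LeftRegular

variable {K H : Type*} [Group K] [Fintype K] [NormedAddCommGroup H] [InnerProductSpace ℂ H]
  (e : OrthonormalBasis K ℂ H)

/-- The left regular representation of `K` on a Hilbert space with an orthonormal basis indexed
by `K`. -/
noncomputable def leftRegular : K →* (H →L[ℂ] H) where
  toFun ξ := e.equiv e (Equiv.mulLeft ξ)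
  map_one' := by
    rw [Equiv.mulLeft_one]
    exact ContinuousLinearMap.ext fun x => by simp [Equiv.Perm.one_def]
  map_mul' ξ η := ContinuousLinearMap.coe_injective <| e.toBasis.ext fun χ => by
    simp

theorem leftRegular_apply_basis (ξ χ : K) : leftRegular e ξ (e χ) = e (ξ * χ) := by
  simp [leftRegular]

theorem star_leftRegular [CompleteSpace H] (ξ : K) :
    star (leftRegular e ξ) = leftRegular e ξ⁻¹ := by
  simp only [leftRegular, MonoidHom.coe_mk, OneHom.coe_mk, LinearIsometryEquiv.star_eq_symm,
    OrthonormalBasis.equiv_symm, Equiv.mulLeft_symm]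

end LeftRegular

/-! ### Untwisting the action -/

section Untwisting

open CrossedProduct InnerProductSpace

theorem span_range_singleₗ_tmul {K H B : Type*} [Group K] [Fintype K] [NormedAddCommGroup H]
    [InnerProductSpace ℂ H] [Ring B] [StarRing B] [Algebra ℂ B] (α : K →* (B ≃⋆ₐ[ℂ] B))
    (e : OrthonormalBasis K ℂ H) :
    Submodule.span ℂ (Set.range fun p : K × K × B => singleₗ α p.1 p.2.2 ⊗ₜ[ℂ] e p.2.1) = ⊤ := by
  rw [eq_top_iff, ← TensorProduct.span_tmul_eq_top, Submodule.span_le]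
  rintro _ ⟨x, η, rfl⟩
  rw [← sum_singleₗ_coeff x, ← e.sum_repr η, TensorProduct.sum_tmul]
  simp_rw [TensorProduct.tmul_sum, TensorProduct.tmul_smul]
  exact sum_mem fun ξ _ => sum_mem fun χ _ => Submodule.smul_mem _ _ <|
    Submodule.subset_span ⟨(ξ, χ, x.coeff ξ), rfl⟩

variable {K H B C : Type*} [Fintype K] [NormedAddCommGroup H] [InnerProductSpace ℂ H]
  [CompleteSpace H] [Ring B] [StarRing B] [Algebra ℂ B] [Ring C] [StarRing C] [Algebra ℂ C]
  [StarModule ℂ C]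

/-- The block diagonal direct sum of a family of `*`-homomorphisms `B → C`. -/
noncomputable def diagonalHom (e : OrthonormalBasis K ℂ H) (φ : K → B →⋆ₐ[ℂ] C) :
    B →⋆ₐ[ℂ] C ⊗[ℂ] (H →L[ℂ] H) where
  toFun b := ∑ χ, φ χ b ⊗ₜ rankOne ℂ (e χ) (e χ)
  map_one' := by
    simp_rw [map_one, ← TensorProduct.tmul_sum]
    rw [e.sum_rankOne_eq_id]
    rfl
  map_mul' a b := by
    classical
    refine .trans ?_ (Finset.sum_mul_sum _ _ _ _).symm
    simp only [Algebra.TensorProduct.tmul_mul_tmul, ContinuousLinearMap.mul_def,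
      rankOne_comp_rankOne, orthonormal_iff_ite.1 e.orthonormal, ite_smul, one_smul, zero_smul,
      TensorProduct.tmul_ite, Finset.sum_ite_eq, Finset.mem_univ, if_true, map_mul]
  map_zero' := by simp
  map_add' a b := by simp [TensorProduct.add_tmul, Finset.sum_add_distrib]
  commutes' c := by
    simp_rw [AlgHomClass.commutes]
    simp_rw [← TensorProduct.tmul_sum]
    rw [e.sum_rankOne_eq_id]
    rfl
  map_star' b := by
    refine .trans ?_ (star_sum _ _).symm
    simp_rw [TensorProduct.star_tmul, ContinuousLinearMap.star_eq_adjoint, adjoint_rankOne,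
      map_star]

variable [Group K] [StarModule ℂ B] (α : K →* (B ≃⋆ₐ[ℂ] B)) (e : OrthonormalBasis K ℂ H)

/-- The representation `ξ ↦ u_ξ ⊗ λ_ξ`, where `λ` is the left regular representation. -/
noncomputable def unitaryTmulRegular : K →* CrossedProduct α ⊗[ℂ] (H →L[ℂ] H) where
  toFun ξ := singleₗ α ξ 1 ⊗ₜ leftRegular e ξ
  map_one' := by rw [map_one (leftRegular e)]; rfl
  map_mul' ξ η := by
    rw [Algebra.TensorProduct.tmul_mul_tmul, singleₗ_mul_singleₗ, map_one (α ξ), mul_one,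
      map_mul (leftRegular e)]

theorem star_unitaryTmulRegular (ξ : K) :
    star (unitaryTmulRegular α e ξ) = unitaryTmulRegular α e ξ⁻¹ := by
  refine (TensorProduct.star_tmul _ _).trans ?_
  rw [star_singleₗ, star_leftRegular, star_one, map_one]
  rfl

/-- The representation `b ↦ ∑ χ, α_χ(b) ⊗ |e_χ⟩⟨e_χ|`. -/
noncomputable def twistedDiagonal : B →⋆ₐ[ℂ] CrossedProduct α ⊗[ℂ] (H →L[ℂ] H) :=
  diagonalHom e fun χ => (embed α).comp (α χ : B →⋆ₐ[ℂ] B)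

theorem unitaryTmulRegular_mul_twistedDiagonal (ξ : K) (b : B) :
    unitaryTmulRegular α e ξ * twistedDiagonal α e b =
      ∑ χ, singleₗ α ξ (α (ξ * χ) b) ⊗ₜ rankOne ℂ (e (ξ * χ)) (e χ) := by
  change (singleₗ α ξ 1 ⊗ₜ leftRegular e ξ) *
    (∑ χ, singleₗ α 1 (α χ b) ⊗ₜ rankOne ℂ (e χ) (e χ)) = _
  refine (Finset.mul_sum (R := CrossedProduct α ⊗[ℂ] (H →L[ℂ] H)) _ _ _).trans ?_
  simp_rw [Algebra.TensorProduct.tmul_mul_tmul, singleₗ_mul_singleₗ,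
    ContinuousLinearMap.mul_def, comp_rankOne, leftRegular_apply_basis, mul_one, one_mul, map_mul,
    StarAlgEquiv.mul_apply]

theorem twistedDiagonal_mul_unitaryTmulRegular (ξ : K) (b : B) :
    twistedDiagonal α e b * unitaryTmulRegular α e ξ =
      ∑ χ, singleₗ α ξ (α (ξ * χ) b) ⊗ₜ rankOne ℂ (e (ξ * χ)) (e χ) := by
  change (∑ χ, singleₗ α 1 (α χ b) ⊗ₜ rankOne ℂ (e χ) (e χ)) *
    (singleₗ α ξ 1 ⊗ₜ leftRegular e ξ) = _
  refine (Finset.sum_mul (R := CrossedProduct α ⊗[ℂ] (H →L[ℂ] H)) _ _ _).trans ?_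
  simp_rw [Algebra.TensorProduct.tmul_mul_tmul, singleₗ_mul_singleₗ,
    ContinuousLinearMap.mul_def, rankOne_comp, ← ContinuousLinearMap.star_eq_adjoint,
    star_leftRegular, leftRegular_apply_basis, map_one, mul_one, one_mul]
  exact Fintype.sum_equiv (Equiv.mulLeft ξ⁻¹) _ _ fun χ => by simp

/-- The quantum isomorphism from the crossed product by the trivial action to the crossed product
by `α`. -/
noncomputable def untwist :
    CrossedProduct (1 : K →* (B ≃⋆ₐ[ℂ] B)) →⋆ₐ[ℂ] CrossedProduct α ⊗[ℂ] (H →L[ℂ] H) :=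
  lift (C := CrossedProduct α ⊗[ℂ] (H →L[ℂ] H)) (twistedDiagonal α e) (unitaryTmulRegular α e)
    (star_unitaryTmulRegular α e) fun ξ b =>
    (unitaryTmulRegular_mul_twistedDiagonal α e ξ b).trans
      (twistedDiagonal_mul_unitaryTmulRegular α e ξ b).symm

theorem untwist_singleₗ (ξ : K) (b : B) : untwist α e (singleₗ 1 ξ b) =
    ∑ χ, singleₗ α ξ (α (ξ * χ) b) ⊗ₜ rankOne ℂ (e (ξ * χ)) (e χ) :=
  (lift_singleₗ ..).trans (twistedDiagonal_mul_unitaryTmulRegular α e ξ b)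

theorem isoMap_untwist_singleₗ_tmul (ξ χ : K) (b : B) :
    isoMap (untwist α e) (singleₗ 1 ξ b ⊗ₜ e χ) = singleₗ α ξ (α (ξ * χ) b) ⊗ₜ e (ξ * χ) := by
  classical
  simp [isoMap, untwist_singleₗ, tensorAct, orthonormal_iff_ite.1 e.orthonormal,
    TensorProduct.tmul_ite]

theorem untwist_mapCoeff {s : K → B →ₗ[ℂ] B} (hs : ∀ ξ χ b, s ξ (α χ b) = α χ (s ξ b))
    (x : CrossedProduct (1 : K →* (B ≃⋆ₐ[ℂ] B))) :
    untwist α e (mapCoeff s x) =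
      TensorProduct.map (mapCoeff s) LinearMap.id (untwist α e x) := by
  rw [← sum_singleₗ_coeff x]
  simp only [map_sum, mapCoeff_singleₗ, untwist_singleₗ, TensorProduct.map_tmul, hs,
    LinearMap.id_apply]

theorem isQuantumSetIso_untwist {ψ : B →ₗ[ℂ] ℂ} (hψ : (gns ψ).SeparatingRight)
    (hα : ∀ χ b, ψ (α χ b) = ψ b) :
    IsQuantumSetIso (functional 1 ψ) (functional α ψ) (untwist α e) := by
  classical
  have inner_separatingRight : (innerₛₗ ℂ : Sesq H).SeparatingRight := fun η hη =>
    inner_self_eq_zero.1 (hη η)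
  refine isUnitary_of_span (separatingRight_tensorForm
    (separatingRight_gns_functional (fun _ _ => rfl) hψ) inner_separatingRight)
    (span_range_singleₗ_tmul 1 e) ?_ ?_
  · let φ : K × K × B → K × K × B := fun p => (p.1, p.1 * p.2.1, α (p.1 * p.2.1) p.2.2)
    have φ_surjective : Function.Surjective φ := fun ⟨ξ, χ, b⟩ =>
      ⟨(ξ, ξ⁻¹ * χ, α χ⁻¹ b), by simp only [φ, mul_inv_cancel_left, act_act_inv]⟩
    have isoMap_comp : isoMap (untwist α e) ∘ (fun p => singleₗ 1 p.1 p.2.2 ⊗ₜ e p.2.1) =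
        (fun p => singleₗ α p.1 p.2.2 ⊗ₜ e p.2.1) ∘ φ :=
      funext fun p => isoMap_untwist_singleₗ_tmul α e p.1 p.2.1 p.2.2
    rw [← span_range_singleₗ_tmul α e, ← Set.range_comp, isoMap_comp, φ_surjective.range_comp]
  · rintro _ ⟨⟨ξ, χ, b⟩, rfl⟩ _ ⟨⟨η, ζ, c⟩, rfl⟩
    simp only [isoMap_untwist_singleₗ_tmul, tensorForm_tmul, gns_functional_singleₗ hα,
      gns_functional_singleₗ (α := 1) fun _ _ => rfl, coeff_singleₗ, innerₛₗ_apply_apply,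
      orthonormal_iff_ite.1 e.orthonormal]
    obtain rfl | h := eq_or_ne η ξ
    · obtain rfl | h := eq_or_ne χ ζ
      · have : gns ψ (α (η * χ) b) (α (η * χ) c) = gns ψ b c := by
          rw [gns_apply, ← map_star, ← map_mul, hα, gns_apply]
        simp only [Pi.single_eq_same, this]
      · simp [h]
    · simp [h]

end Untwisting

section VoltageUntwisting

open CrossedProduct

variable {G B : Type*} [AddCommGroup G] [Fintype G] [Ring B] [StarRing B] [Algebra ℂ B]
  [StarModule ℂ B] {ψ : B →ₗ[ℂ] ℂ} {α : AddChar G ℂ →* (B ≃⋆ₐ[ℂ] B)} {A : G → B →ₗ[ℂ] B}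

theorem IsVoltageQuantumGraph.quantumIsomorphic_trivialAction
    (h : IsVoltageQuantumGraph ψ α A) :
    QuantumIsomorphic (functional 1 ψ) (derivedQuantumGraph ψ 1 A)
      (functional α ψ) (derivedQuantumGraph ψ α A) := by
  let e := (EuclideanSpace.basisFun _ ℂ).reindex (Fintype.equivFin (AddChar G ℂ)).symm
  have : NeZero (Fintype.card (AddChar G ℂ)) := ⟨Fintype.card_ne_zero⟩
  refine ⟨h.trivialAction.isQuantumGraph_derivedQuantumGraph,
    h.isQuantumGraph_derivedQuantumGraph, _, _, _, inferInstance, untwist α e, inferInstance,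
    inferInstance, isQuantumSetIso_untwist α e h.quantumSet.separatingRight h.action, fun x => ?_⟩
  rw [derivedQuantumGraph_eq_mapCoeff h, derivedQuantumGraph_eq_mapCoeff h.trivialAction]
  exact untwist_mapCoeff α e h.fourierTransform_act x

end VoltageUntwisting

section Transport

variable {B₁ : Type*} [Ring B₁] [StarRing B₁] [Algebra ℂ B₁]
  {B₁' : Type*} [Ring B₁'] [StarRing B₁'] [Algebra ℂ B₁']
  {B₂ : Type*} [Ring B₂] [StarRing B₂] [Algebra ℂ B₂] [StarModule ℂ B₂]

theorem isoMap_comp {H : Type*} [NormedAddCommGroup H] [InnerProductSpace ℂ H] [CompleteSpace H]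
    (ρ : B₁ →⋆ₐ[ℂ] B₂ ⊗[ℂ] (H →L[ℂ] H)) (φ : B₁' →⋆ₐ[ℂ] B₁) :
    isoMap (ρ.comp φ) = isoMap ρ ∘ₗ TensorProduct.map (φ : B₁' →ₗ[ℂ] B₁) LinearMap.id :=
  TensorProduct.ext' fun _ _ => rfl

variable [StarModule ℂ B₁] [StarModule ℂ B₁'] {ψ₁ : B₁ →ₗ[ℂ] ℂ} {A₁ : B₁ →ₗ[ℂ] B₁}
  {ψ₁' : B₁' →ₗ[ℂ] ℂ} {A₁' : B₁' →ₗ[ℂ] B₁'} {ψ₂ : B₂ →ₗ[ℂ] ℂ} {A₂ : B₂ →ₗ[ℂ] B₂}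

theorem QuantumIsomorphic.congr_left (h : QuantumIsomorphic ψ₁ A₁ ψ₂ A₂)
    (h' : IsQuantumGraph ψ₁' A₁') (φ : B₁ ≃⋆ₐ[ℂ] B₁') (hψ : ∀ a, ψ₁' (φ a) = ψ₁ a)
    (hA : ∀ a, φ (A₁ a) = A₁' (φ a)) : QuantumIsomorphic ψ₁' A₁' ψ₂ A₂ := by
  obtain ⟨-, h₂, H, _, _, _, ρ, hfin, hnontrivial, hρ, hρA⟩ := h
  refine ⟨h', h₂, H, _, _, _, ρ.comp (φ.symm : B₁' →⋆ₐ[ℂ] B₁), hfin, hnontrivial, ?_, fun a => ?_⟩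
  · have symm_isUnitary :
        IsUnitary (gns ψ₁') (gns ψ₁) ((φ.symm : B₁' →⋆ₐ[ℂ] B₁) : B₁' →ₗ[ℂ] B₁) :=
      ⟨φ.symm.bijective, fun a b => by simp [← hψ, map_star]⟩
    have id_isUnitary : IsUnitary (innerₛₗ ℂ) (innerₛₗ ℂ) (LinearMap.id : H →ₗ[ℂ] H) :=
      ⟨Function.bijective_id, fun _ _ => rfl⟩
    rw [IsQuantumSetIso, isoMap_comp]
    exact hρ.comp (symm_isUnitary.map id_isUnitary)
  · change ρ (φ.symm (A₁' a)) = TensorProduct.map A₂ LinearMap.id (ρ (φ.symm a))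
    rw [← hρA, ← φ.symm_apply_apply (A₁ (φ.symm a)), hA, φ.apply_symm_apply]

end Transport

/-! ### Classical graphs -/

section ClassicalGraphs

variable {V E : Type*} [Fintype V]

theorem classicalFunctional_apply (f : V → ℂ) : classicalFunctional V f = ∑ v, f v := rfl

theorem separatingRight_gns_classicalFunctional :
    (gns (classicalFunctional V)).SeparatingRight := by
  classical
  intro f hf
  ext v
  simpa [classicalFunctional_apply, Pi.single_apply] using hf (Pi.single v 1)

variable [DecidableEq V]

theorem comul_classicalFunctional_single (v : V) :
    comul (classicalFunctional V) (Pi.single v 1) = Pi.single v 1 ⊗ₜ Pi.single v 1 :=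
  comul_eq separatingRight_gns_classicalFunctional fun f f' => by
    simp [classicalFunctional_apply, Pi.single_apply]

theorem schur_classicalFunctional_single (S T : (V → ℂ) →ₗ[ℂ] (V → ℂ)) (v : V) :
    schur (classicalFunctional V) S T (Pi.single v 1) =
      S (Pi.single v 1) * T (Pi.single v 1) := by
  simp [schur, comul_classicalFunctional_single]

variable (V) in
omit [DecidableEq V] in
theorem isQuantumSet_classicalFunctional : IsQuantumSet (classicalFunctional V) := by
  classical
  have nonneg (f : V → ℂ) (v : V) : 0 ≤ (star f * f) v := star_mul_self_nonneg (f v)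
  refine ⟨isFinDimCStarAlgebra_of_injective (A := V → ℂ) (StarAlgHom.id ℂ _)
    Function.injective_id, fun f => Finset.sum_nonneg fun v _ => nonneg f v, fun f hf => ?_, ?_⟩
  · rw [classicalFunctional_apply, Finset.sum_eq_zero_iff_of_nonneg fun v _ => nonneg f v] at hf
    ext v
    simpa using hf v (Finset.mem_univ v)
  · rw [← schur_id]
    refine (Pi.basisFun ℂ V).ext fun v => ?_
    simp [schur_classicalFunctional_single, ← Pi.single_mul]

namespace MultiDigraph

/-- There is an edge from `v` to `w`. -/
def Adj (Γ : MultiDigraph V E) (v w : V) : Prop := ∃ e, Γ.src e = v ∧ Γ.tgt e = w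

/-- A digraph is simple if it has no parallel edges; loops are allowed. -/
def IsSimple (Γ : MultiDigraph V E) : Prop :=
  ∀ e f, Γ.src e = Γ.src f → Γ.tgt e = Γ.tgt f → e = f

variable [Fintype E] {Γ : MultiDigraph V E}

omit [Fintype V] in
theorem adjacencyMap_apply (Γ : MultiDigraph V E) (f : V → ℂ) (w : V) :
    Γ.adjacencyMap f w = ∑ e, if Γ.tgt e = w then f (Γ.src e) else 0 := rfl

namespace IsSimple

open Classical in
theorem adjacencyMap_apply (hΓ : Γ.IsSimple) (f : V → ℂ) (w : V) :
    Γ.adjacencyMap f w = ∑ v, if Γ.Adj v w then f v else 0 := by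
  simp_rw [Γ.adjacencyMap_apply, ← Finset.sum_filter]
  refine Finset.sum_nbij Γ.src (fun e he => ?_) (fun e he e' he' h => ?_) (fun v hv => ?_)
    fun _ _ => rfl
  · exact (Finset.mem_filter_univ _).2 ⟨e, rfl, (Finset.mem_filter_univ e).1 he⟩
  · exact hΓ e e' h <| ((Finset.mem_filter_univ e).1 he).trans
      ((Finset.mem_filter_univ e').1 he').symm
  · obtain ⟨e, rfl, rfl⟩ := (Finset.mem_filter_univ v).1 hv
    exact ⟨e, (Finset.mem_filter_univ e).2 rfl, rfl⟩

theorem isQuantumAdjacencyMatrix (hΓ : Γ.IsSimple) :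
    IsQuantumAdjacencyMatrix (classicalFunctional V) Γ.adjacencyMap where
  schur_idem := (Pi.basisFun ℂ V).ext fun v => by
    classical
    have adjacencyMap_single (w : V) :
        Γ.adjacencyMap (Pi.single v 1) w = if Γ.Adj v w then 1 else 0 := by
      rw [hΓ.adjacencyMap_apply, Finset.sum_eq_single v] <;> simp +contextual
    ext w
    simp [schur_classicalFunctional_single, adjacencyMap_single]
  star_preserving f := by
    ext w
    simp [Γ.adjacencyMap_apply, apply_ite (starRingEnd ℂ)]

theorem isQuantumGraph (hΓ : Γ.IsSimple) :
    IsQuantumGraph (classicalFunctional V) Γ.adjacencyMap :=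
  ⟨isQuantumSet_classicalFunctional V, hΓ.isQuantumAdjacencyMatrix⟩

theorem adjacencyMap_permAction {V K : Type*} [Finite V] [DecidableEq V] [Group K]
    {Γ : MultiDigraph V E} (hΓ : Γ.IsSimple) {α : K →* Equiv.Perm V} {χ : K}
    (hα : ∀ v w, Γ.Adj (α χ v) (α χ w) ↔ Γ.Adj v w) (f : V → ℂ) :
    Γ.adjacencyMap (permAction α χ f) = permAction α χ (Γ.adjacencyMap f) := by
  classical
  have := Fintype.ofFinite V
  have permAction_apply (f : V → ℂ) (v : V) : permAction α χ f v = f ((α χ)⁻¹ v) := rfl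
  ext w
  rw [permAction_apply, hΓ.adjacencyMap_apply, hΓ.adjacencyMap_apply,
    ← Equiv.sum_comp (α χ)]
  refine Finset.sum_congr rfl fun v _ => ?_
  simp [permAction_apply, ← hα v]

end IsSimple

end MultiDigraph

theorem classicalFunctional_permAction {K V : Type*} [Group K] [Fintype V]
    (α : K →* Equiv.Perm V) (χ : K) (f : V → ℂ) :
    classicalFunctional V (permAction α χ f) = classicalFunctional V f :=
  Equiv.sum_comp (α χ)⁻¹ f

end ClassicalGraphs

/-! ### The derived graph of a voltage graph -/

namespace VoltageGraph

section Simple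

variable {V E G : Type*} {Γ : VoltageGraph V E G}

theorem IsPreSimple.isSimple_labeled (hΓ : Γ.IsPreSimple) (g : G) : (Γ.labeled g).IsSimple :=
  fun e f hsrc htgt => Subtype.ext (hΓ e f hsrc htgt (e.2.trans f.2.symm))

theorem IsPreSimple.isSimple_derivedGraph [Add G] [IsLeftCancelAdd G] (hΓ : Γ.IsPreSimple) :
    Γ.derivedGraph.IsSimple := by
  rintro ⟨e, g⟩ ⟨f, h⟩ hsrc htgt
  obtain ⟨hsrc, rfl⟩ := Prod.mk.inj hsrc
  obtain ⟨htgt, hlabel⟩ := Prod.mk.inj htgt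
  rw [hΓ e f hsrc htgt (add_left_cancel hlabel)]

theorem labeled_adj_iff (g : G) (v w : V) : (Γ.labeled g).Adj v w ↔ (v, w) ∈ Γ.edgeSet g :=
  ⟨fun ⟨e, hsrc, htgt⟩ => ⟨e, e.2, hsrc, htgt⟩,
    fun ⟨e, hlabel, hsrc, htgt⟩ => ⟨⟨e, hlabel⟩, hsrc, htgt⟩⟩

theorem IsInvariant.labeled_adj_iff {K : Type*} [Group K] {α : K →* Equiv.Perm V}
    (hα : Γ.IsInvariant α) (χ : K) (g : G) (v w : V) :
    (Γ.labeled g).Adj (α χ v) (α χ w) ↔ (Γ.labeled g).Adj v w := by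
  rw [Γ.labeled_adj_iff, Γ.labeled_adj_iff]
  nth_rw 1 [← hα χ g]
  exact ((α χ).injective.prodMap (α χ).injective).mem_set_image (a := (v, w))

end Simple

theorem IsPreSimple.isVoltageQuantumGraph {V E G : Type*} [Fintype V] [DecidableEq V] [Fintype E]
    [AddCommGroup G] [DecidableEq G] {Γ : VoltageGraph V E G} (hΓ : Γ.IsPreSimple)
    {α : AddChar G ℂ →* Equiv.Perm V} (hα : Γ.IsInvariant α) :
    IsVoltageQuantumGraph (classicalFunctional V) (permAction α) Γ.adjacencyFamily where
  quantumSet := isQuantumSet_classicalFunctional V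
  action := classicalFunctional_permAction α
  adjacency g := (hΓ.isSimple_labeled g).isQuantumAdjacencyMatrix
  commute g χ := (hΓ.isSimple_labeled g).adjacencyMap_permAction (hα.labeled_adj_iff χ g)

theorem derivedGraph_adjacencyMap_apply {V E G : Type*} [DecidableEq V] [Fintype E] [AddGroup G]
    [Fintype G] [DecidableEq G] (Γ : VoltageGraph V E G) (f : V × G → ℂ) (w : V) (k : G) :
    Γ.derivedGraph.adjacencyMap f (w, k) =
      ∑ g, Γ.adjacencyFamily g (fun v => f (v, k - g)) w := by
  have sum_fiber (e : E) :
      (∑ h, if Γ.derivedGraph.tgt (e, h) = (w, k) then f (Γ.derivedGraph.src (e, h)) else 0) =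
        if Γ.tgt e = w then f (Γ.src e, k - Γ.label e) else 0 := by
    simp only [derivedGraph, Prod.mk.injEq, ← eq_sub_iff_add_eq, ite_and]
    split_ifs <;> simp
  rw [MultiDigraph.adjacencyMap_apply, Fintype.sum_prod_type]
  simp only [sum_fiber]
  rw [← (Equiv.sigmaFiberEquiv Γ.label).sum_comp, Fintype.sum_sigma]
  refine Finset.sum_congr rfl fun g _ => Finset.sum_congr rfl fun e _ => ?_
  obtain ⟨e, rfl⟩ := e
  rfl

end VoltageGraph

section Fourier

open CrossedProduct

variable {V G : Type*} [AddCommGroup G] [Fintype G]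

variable (V G) in
/-- The Fourier transform `f u_ξ ↦ f ⊗ ξ`, identifying the crossed product of `ℂ^V` by the trivial
action of the dual group of `G` with `ℂ^(V × G)`. -/
noncomputable def fourierHom :
    CrossedProduct (1 : AddChar G ℂ →* ((V → ℂ) ≃⋆ₐ[ℂ] (V → ℂ))) →⋆ₐ[ℂ] (V × G → ℂ) :=
  lift
    { toFun := fun f p => f p.1
      map_one' := rfl
      map_mul' := fun _ _ => rfl
      map_zero' := rfl
      map_add' := fun _ _ => rfl
      commutes' := fun _ => rfl
      map_star' := fun _ => rfl }
    { toFun := fun ξ p => ξ p.2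
      map_one' := rfl
      map_mul' := fun _ _ => rfl }
    (fun ξ => funext fun p => (AddChar.map_neg_eq_conj ξ p.2).symm)
    (fun _ _ => mul_comm _ _)

theorem fourierHom_singleₗ (ξ : AddChar G ℂ) (f : V → ℂ) (p : V × G) :
    fourierHom V G (singleₗ 1 ξ f) p = f p.1 * ξ p.2 :=
  congrFun (lift_singleₗ ..) p

theorem fourierHom_mapCoeff_fourierTransform {E : Type*} [DecidableEq V] [DecidableEq G]
    [Fintype E] (Γ : VoltageGraph V E G)
    (x : CrossedProduct (1 : AddChar G ℂ →* ((V → ℂ) ≃⋆ₐ[ℂ] (V → ℂ)))) :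
    fourierHom V G (mapCoeff (fourierTransform Γ.adjacencyFamily) x) =
      Γ.derivedGraph.adjacencyMap (fourierHom V G x) := by
  rw [← sum_singleₗ_coeff x]
  simp only [map_sum, mapCoeff_singleₗ]
  refine Finset.sum_congr rfl fun ξ _ => ?_
  ext ⟨w, k⟩
  have fiber (g : G) : (fun v => fourierHom V G (singleₗ 1 ξ (x.coeff ξ)) (v, k - g)) =
      (ξ k * conj (ξ g)) • x.coeff ξ := funext fun v => by
    rw [fourierHom_singleₗ, sub_eq_add_neg, AddChar.map_add_eq_mul, AddChar.map_neg_eq_conj]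
    exact mul_comm _ _
  rw [Γ.derivedGraph_adjacencyMap_apply, fourierHom_singleₗ]
  simp only [fiber, map_smul, fourierTransform, LinearMap.sum_apply, LinearMap.smul_apply,
    Finset.sum_apply, Pi.smul_apply, Finset.sum_mul, smul_eq_mul]
  exact Finset.sum_congr rfl fun g _ => by ring

variable [Fintype V]

theorem classicalFunctional_fourierHom
    (x : CrossedProduct (1 : AddChar G ℂ →* ((V → ℂ) ≃⋆ₐ[ℂ] (V → ℂ)))) :
    classicalFunctional (V × G) (fourierHom V G x) = functional 1 (classicalFunctional V) x := by
  classical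
  rw [← sum_singleₗ_coeff x]
  simp only [map_sum]
  refine Finset.sum_congr rfl fun ξ _ => ?_
  simp only [classicalFunctional_apply, fourierHom_singleₗ, functional_apply, coeff_singleₗ,
    Fintype.sum_prod_type, ← Finset.mul_sum, ← Finset.sum_mul, AddChar.sum_eq_ite]
  obtain rfl | h := eq_or_ne ξ 1
  · simp [← AddChar.one_eq_zero, mul_comm]
  · simp [← AddChar.one_eq_zero, h, h.symm]

omit [Fintype V] in
variable (V G) in
theorem fourierHom_bijective [Finite V] : Function.Bijective (fourierHom V G) := by
  have := Fintype.ofFinite V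
  have quantumSet := (isQuantumSet_classicalFunctional V).crossedProduct
    (α := (1 : AddChar G ℂ →* ((V → ℂ) ≃⋆ₐ[ℂ] (V → ℂ)))) fun _ _ => rfl
  have injective : Function.Injective (fourierHom V G) :=
    (injective_iff_map_eq_zero _).2 fun x hx => quantumSet.faithful x <| by
      rw [← classicalFunctional_fourierHom, map_mul, hx, mul_zero, map_zero]
  have finrank_eq : Module.finrank ℂ
      (CrossedProduct (1 : AddChar G ℂ →* ((V → ℂ) ≃⋆ₐ[ℂ] (V → ℂ)))) =
      Module.finrank ℂ (V × G → ℂ) := by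
    rw [(coeffEquiv _).finrank_eq]
    simp [Module.finrank_pi_fintype, AddChar.card_eq, mul_comm]
  exact ⟨injective, (LinearMap.injective_iff_surjective_of_finrank_eq_finrank finrank_eq
    (f := (fourierHom V G).toAlgHom.toLinearMap)).1 injective⟩

variable (V G) in
/-- The isomorphism given by `fourierHom`. -/
noncomputable def fourierEquiv :
    CrossedProduct (1 : AddChar G ℂ →* ((V → ℂ) ≃⋆ₐ[ℂ] (V → ℂ))) ≃⋆ₐ[ℂ] (V × G → ℂ) :=
  StarAlgEquiv.ofBijective (fourierHom V G) (fourierHom_bijective V G)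

end Fourier

end QGraph

theorem mainTheorem4 {V E G : Type*} [Fintype V] [DecidableEq V] [Fintype E]
    [AddCommGroup G] [Fintype G] [DecidableEq G]
    (Γ : QGraph.VoltageGraph V E G) (hΓ : Γ.IsPreSimple)
    (α : AddChar G ℂ →* Equiv.Perm V) (hα : Γ.IsInvariant α) :
    QGraph.IsVoltageQuantumGraph (QGraph.classicalFunctional V) (QGraph.permAction α)
        Γ.adjacencyFamily ∧
      QGraph.QuantumIsomorphic
        (QGraph.classicalFunctional (V × G)) Γ.derivedGraph.adjacencyMap
        (QGraph.CrossedProduct.functional (QGraph.permAction α) (QGraph.classicalFunctional V))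
        (QGraph.derivedQuantumGraph (QGraph.classicalFunctional V) (QGraph.permAction α)
          Γ.adjacencyFamily) := by
  have h := hΓ.isVoltageQuantumGraph hα
  refine ⟨h, h.quantumIsomorphic_trivialAction.congr_left
    hΓ.isSimple_derivedGraph.isQuantumGraph (QGraph.fourierEquiv V G) ?_ ?_⟩
  · exact QGraph.classicalFunctional_fourierHom
  · intro x
    rw [QGraph.derivedQuantumGraph_eq_mapCoeff h.trivialAction]
    exact QGraph.fourierHom_mapCoeff_fourierTransform Γ x
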